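/- Let $d$ be a positive integer. A free minimal Cantor system $(X,\varphi,\mathbb{Z}^d)$ is a Cantor set $X$ with an action $v\mapsto\varphi^v$ of $\mathbb{Z}^d$ on $X$ by homeomorphisms that is free and has all orbits dense. A bounded orbit injection from $(X,\varphi,\mathbb{Z}^d)$ to $(Y,\psi,\mathbb{Z}^d)$ is a continuous open injection $\theta:X\to Y$ such that two points $x,y\in X$ lie in the same $\varphi$-orbit if and only if $\theta(x),\theta(y)$ lie in the same $\psi$-orbit, and such that the cocycle $\eta:X\times\mathbb{Z}^d\to\mathbb{Z}^d$ determined by $\psi^{\eta(x,w)}\theta(x)=\theta(\varphi^w x)$ is continuous. Let $G(\varphi)=C(X,\mathbb{Z})/\langle f-f\circ\varphi^v : f\in C(X,\mathbb{Z}),\,v\in\mathbb{Z}^d\rangle$ and $G(\varphi)_+=\{[f]: f(x)\ge 0\text{ for all }x\in X\}$; write $a\le b$ if $b-a\in G(\varphi)_+$, and $a<b$ if $a\le b$ and $a\ne b$. A bounded orbit injection $\theta$ from $(X,\varphi,\mathbb{Z}^d)$ to $(Z,\alpha,\mathbb{Z}^d)$ induces a homomorphism $h_\theta:G(\varphi)\to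 G(\alpha)$ with $h_\theta[1_A]=[1_{\theta(A)}]$ for every clopen $A\subset X$. **Theorem.** Let $(X,\varphi,\mathbb{Z}^d)$, $(Y,\psi,\mathbb{Z}^d)$ and $(Z,\alpha,\mathbb{Z}^d)$ be free minimal Cantor systems, and let $\theta_1$ and $\theta_2$ be bounded orbit injections from $(X,\varphi,\mathbb{Z}^d)$ and from $(Y,\psi,\mathbb{Z}^d)$, respectively, to $(Z,\alpha,\mathbb{Z}^d)$. If $h_{\theta_1}[1_X]<h_{\theta_2}[1_Y]$ in $G(\alpha)$, then there is a bounded orbit injection from $(X,\varphi,\mathbb{Z}^d)$ to $(Y,\psi,\mathbb{Z}^d)$. -/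

import Mathlib

open Topology

noncomputable section

namespace OrbitInj

/-- The acting group `ℤ^d`. An action of `ℤ^d` by homeomorphisms is an
`AddAction (Zd d) X` together with `ContinuousConstVAdd (Zd d) X`; the point `φ^v x` is written
`v +ᵥ x`. Freeness is `IsCancelVAdd` and minimality (all orbits are dense) is
`AddAction.IsMinimal`. -/
abbrev Zd (d : ℕ) : Type := Fin d → ℤ

/-- A Cantor set: a nonempty, compact, metrizable, totally disconnected space without isolated
points. -/
class IsCantorSpace (X : Type*) [TopologicalSpace X] : Prop where
  nonempty : Nonempty X
  compact : CompactSpace X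
  metrizable : TopologicalSpace.MetrizableSpace X
  totallyDisconnected : TotallyDisconnectedSpace X
  perfect : PerfectSpace X

attribute [instance] IsCantorSpace.nonempty IsCantorSpace.compact IsCantorSpace.metrizable
  IsCantorSpace.totallyDisconnected IsCantorSpace.perfect

/-- Orbit injections: continuous open injections such that two points lie in the same orbit if
and only if their images do. -/
structure IsOrbitInjection (d : ℕ) {X Y : Type*} [TopologicalSpace X] [TopologicalSpace Y]
    [AddAction (Zd d) X] [AddAction (Zd d) Y] (θ : X → Y) : Prop where
  continuous : Continuous θ
  isOpenMap : IsOpenMap θ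
  injective : Function.Injective θ
  orbit_iff : ∀ x y : X, (∃ w : Zd d, w +ᵥ x = y) ↔ ∃ v : Zd d, v +ᵥ θ x = θ y

/-- Bounded orbit injections: the cocycle `η`, determined by `ψ^{η(x,w)} θ(x) = θ(φ^w x)`
(uniquely, when the target action is free), is continuous on `X × ℤ^d`. -/
structure IsBoundedOrbitInjection (d : ℕ) {X Y : Type*} [TopologicalSpace X] [TopologicalSpace Y]
    [AddAction (Zd d) X] [AddAction (Zd d) Y] (θ : X → Y) : Prop
    extends IsOrbitInjection d θ where
  bounded : ∃ η : X × Zd d → Zd d, Continuous η ∧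
    ∀ (x : X) (w : Zd d), η (x, w) +ᵥ θ x = θ (w +ᵥ x)

section Group

variable (d : ℕ) (X : Type*) [TopologicalSpace X] [AddAction (Zd d) X]
  [ContinuousConstVAdd (Zd d) X]

variable {X} in
/-- The function `f ∘ φ^v`. -/
def translate (v : Zd d) (f : C(X, ℤ)) : C(X, ℤ) :=
  f.comp ⟨fun x => v +ᵥ x, continuous_const_vadd v⟩

/-- The coboundaries: the subgroup of `C(X, ℤ)` generated by all `f - f ∘ φ^v`. -/
def coboundaries : AddSubgroup C(X, ℤ) :=
  AddSubgroup.closure {g | ∃ (f : C(X, ℤ)) (v : Zd d), g = f - translate d v f}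

/-- The dynamical cohomology group `G(φ) = C(X, ℤ) / ⟨f - f ∘ φ^v⟩`. -/
def G : Type _ := C(X, ℤ) ⧸ coboundaries d X

instance : AddCommGroup (G d X) :=
  inferInstanceAs (AddCommGroup (C(X, ℤ) ⧸ coboundaries d X))

variable {X} in
/-- The class `[f]` in `G(φ)`. -/
def cls : C(X, ℤ) →+ G d X := QuotientAddGroup.mk' (coboundaries d X)

/-- The cone `G(φ)₊` of classes of nonnegative functions. -/
def positiveCone : Set (G d X) := {a | ∃ f : C(X, ℤ), (∀ x, 0 ≤ f x) ∧ a = cls d f}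

/-- `a ≤ b` means `b - a ∈ G(φ)₊`. -/
instance : LE (G d X) := ⟨fun a b => b - a ∈ positiveCone d X⟩

/-- `a < b` means `a ≤ b` and `b ≠ a`. -/
instance : LT (G d X) := ⟨fun a b => a ≤ b ∧ b ≠ a⟩

end Group

section Induced

variable {d : ℕ} {X Z : Type*} [TopologicalSpace X] [TopologicalSpace Z]
  [AddAction (Zd d) X] [AddAction (Zd d) Z] {θ : X → Z}

theorem IsBoundedOrbitInjection.isOpenEmbedding (h : IsBoundedOrbitInjection d θ) :
    IsOpenEmbedding θ :=
  .of_continuous_injective_isOpenMap h.continuous h.injective h.isOpenMap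

variable [CompactSpace X] [T2Space Z]

theorem IsBoundedOrbitInjection.continuous_extend (h : IsBoundedOrbitInjection d θ)
    (f : C(X, ℤ)) : Continuous (Function.extend θ f 0) := by
  rw [continuous_iff_continuousAt]
  intro z
  by_cases hz : z ∈ Set.range θ
  · obtain ⟨x, rfl⟩ := hz
    rw [← h.isOpenEmbedding.continuousAt_iff, Function.extend_comp h.injective]
    exact f.continuous.continuousAt
  · have hcl : IsClosed (Set.range θ) := (isCompact_range h.continuous).isClosed
    have : Function.extend θ f 0 =ᶠ[𝓝 z] fun _ => 0 := by
      filter_upwards [hcl.isOpen_compl.mem_nhds hz] with y hy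
      exact Function.extend_apply' _ _ _ hy
    exact continuousAt_const.congr this.symm

/-- The extension by zero along a bounded orbit injection `θ`: the additive map
`C(X, ℤ) → C(Z, ℤ)` that sends `f` to the function equal to `f(x)` at `θ(x)` and to `0` off
`θ(X)`. It sends the indicator `1_A` of a clopen set `A` to `1_{θ(A)}`. -/
def extendByZero (h : IsBoundedOrbitInjection d θ) : C(X, ℤ) →+ C(Z, ℤ) where
  toFun f := ⟨Function.extend θ f 0, h.continuous_extend f⟩
  map_zero' := by
    ext z
    by_cases hz : ∃ x, θ x = z
    · obtain ⟨x, rfl⟩ := hz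
      simp [h.injective.extend_apply]
    · simp [Function.extend_apply' _ _ _ hz]
  map_add' f g := by
    ext z
    by_cases hz : ∃ x, θ x = z
    · obtain ⟨x, rfl⟩ := hz
      simp [h.injective.extend_apply]
    · simp [Function.extend_apply' _ _ _ hz]

theorem extendByZero_apply (h : IsBoundedOrbitInjection d θ) (f : C(X, ℤ)) (x : X) :
    extendByZero h f (θ x) = f x :=
  h.injective.extend_apply _ _ _

theorem extendByZero_apply' (h : IsBoundedOrbitInjection d θ) (f : C(X, ℤ)) (z : Z)
    (hz : ¬ ∃ x, θ x = z) : extendByZero h f z = 0 :=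
  Function.extend_apply' _ _ _ hz

variable [ContinuousConstVAdd (Zd d) X] [ContinuousConstVAdd (Zd d) Z]

theorem extendByZero_mem_coboundaries (h : IsBoundedOrbitInjection d θ) :
    coboundaries d X ≤ (coboundaries d Z).comap (extendByZero h) := by
  classical
  rw [coboundaries, AddSubgroup.closure_le]
  rintro _ ⟨f, v, rfl⟩
  obtain ⟨η, hη, hηθ⟩ := h.bounded
  have hc : Continuous fun x => η (x, v) := hη.comp (by fun_prop)
  have hfin : (Set.range fun x => η (x, v)).Finite := (isCompact_range hc).finite_of_discrete
  -- the indicator of `{x | η (x, v) = u}`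
  let p : Zd d → C(X, ℤ) := fun u =>
    ⟨fun x => if η (x, v) = u then 1 else 0,
      (continuous_of_discreteTopology (f := fun t : Zd d => if t = u then (1 : ℤ) else 0)).comp hc⟩
  have hp : ∑ u ∈ hfin.toFinset, p u = 1 := by
    ext x
    have : η (x, v) ∈ hfin.toFinset := by simp
    simp [p, this]
  have hq : ∑ u ∈ hfin.toFinset, translate d (-v) (p u) = 1 := by
    ext x
    have := DFunLike.congr_fun hp (-v +ᵥ x)
    simpa [translate] using this
  have key : ∀ u, extendByZero h (translate d v f * p u) =
      translate d u (extendByZero h (f * translate d (-v) (p u))) := by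
    intro u
    ext z
    change _ = extendByZero h _ (u +ᵥ z)
    by_cases hz : ∃ y, θ y = u +ᵥ z
    · obtain ⟨y, hy⟩ := hz
      rw [← hy, extendByZero_apply]
      have e := hηθ (-v +ᵥ y) v
      rw [vadd_vadd, add_neg_cancel, zero_vadd, hy] at e
      by_cases hu : η (-v +ᵥ y, v) = u
      · rw [hu, vadd_left_cancel_iff] at e
        rw [← e, extendByZero_apply]
        simp [translate, p, vadd_vadd]
      · have : (f * translate d (-v) (p u)) y = 0 := by simp [translate, p, hu]
        rw [this]
        by_cases hz : ∃ x, θ x = z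
        · obtain ⟨x, rfl⟩ := hz
          rw [extendByZero_apply]
          have : η (x, v) ≠ u := by
            intro hxu
            have e' := hηθ x v
            rw [hxu, ← hy] at e'
            apply hu
            rw [h.injective e', vadd_vadd, neg_add_cancel, zero_vadd, hxu]
          simp [p, this]
        · exact extendByZero_apply' h _ _ hz
    · rw [extendByZero_apply' h _ _ hz]
      by_cases hz' : ∃ x, θ x = z
      · obtain ⟨x, rfl⟩ := hz'
        rw [extendByZero_apply]
        have : η (x, v) ≠ u := by
          rintro rfl
          exact hz ⟨_, (hηθ x v).symm⟩
        simp [p, this]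
      · exact extendByZero_apply' h _ _ hz'
  have hf : extendByZero h f =
      ∑ u ∈ hfin.toFinset, extendByZero h (f * translate d (-v) (p u)) := by
    rw [← map_sum, ← Finset.mul_sum, hq, mul_one]
  have hg : extendByZero h (translate d v f) =
      ∑ u ∈ hfin.toFinset, translate d u (extendByZero h (f * translate d (-v) (p u))) := by
    rw [← Finset.sum_congr rfl fun u _ => key u, ← map_sum, ← Finset.mul_sum, hp, mul_one]
  change extendByZero h (f - translate d v f) ∈ coboundaries d Z
  rw [map_sub, hf, hg, ← Finset.sum_sub_distrib]
  exact AddSubgroup.sum_mem _ fun u _ => AddSubgroup.subset_closure ⟨_, u, rfl⟩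

/-- The homomorphism `h_θ : G(φ) → G(α)` induced by a bounded orbit injection `θ`, given by
`h_θ [1_A] = [1_{θ(A)}]` for clopen `A`. -/
def inducedHom (h : IsBoundedOrbitInjection d θ) : G d X →+ G d Z :=
  QuotientAddGroup.map _ _ (extendByZero h) (extendByZero_mem_coboundaries h)

end Induced

end OrbitInj

end

open Topology

noncomputable section

namespace OrbitInj

/-! Let A and B be the clopen images of X and Y in Z. The strict inequality says that 1_B - 1_A is g
plus a coboundary, with g nonnegative and nonzero. Sums of a coboundary over large boxes are
negligible against the size of the box, while by minimality the sums of g are at least a fixed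
fraction of it. So for some n every box of size n in every orbit holds strictly more points of B
than of A (`exists_box_sum_pos`).

This forces a continuous embedding of A into B along orbits (`exists_isMatching`). Counting shows
that finite subsets of A expand into B by a factor 1 + 1/q. If a partial matching cannot absorb one
more point by changes in a box of size R, Hall's theorem yields a set that grows exponentially with
its radius, which for large R contradicts the polynomial growth of boxes. So new points are added by
local rematching, simultaneously around all points of A in a clopen set with well separated returns.
Finitely many such sets cover Z, and the displacement bound never increases. Finally, θ₂⁻¹ ∘
(matching) ∘ θ₁ is the required map. -/

open Filter

/-! ### Boxes in ℤ^d. -/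

/-- The box of integer vectors with all coordinates of absolute value at most `n`. -/
def box (d n : ℕ) : Finset (Zd d) := Finset.Icc (fun _ => -(n : ℤ)) (fun _ => (n : ℤ))

theorem mem_box {d n : ℕ} {v : Zd d} : v ∈ box d n ↔ ∀ i, |v i| ≤ n := by
  simp only [box, Finset.mem_Icc, Pi.le_def, abs_le, forall_and]

theorem card_box (d n : ℕ) : (box d n).card = (2 * n + 1) ^ d := by
  simp only [box, Pi.card_Icc, Int.card_Icc, Finset.prod_const, Finset.card_univ, Fintype.card_fin]
  congr 1
  omega

theorem zero_mem_box (d n : ℕ) : (0 : Zd d) ∈ box d n := by simp [mem_box]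

theorem add_mem_box {d m n : ℕ} {v w : Zd d} (hv : v ∈ box d m) (hw : w ∈ box d n) :
    v + w ∈ box d (m + n) := by
  rw [mem_box] at *
  intro i
  have := abs_add_le (v i) (w i)
  have := hv i
  have := hw i
  simp only [Pi.add_apply]
  push_cast
  linarith

theorem neg_mem_box {d n : ℕ} {v : Zd d} (hv : v ∈ box d n) : -v ∈ box d n := by
  rw [mem_box] at *
  simpa using hv

theorem sub_mem_box {d m n : ℕ} {v w : Zd d} (hv : v ∈ box d m) (hw : w ∈ box d n) :
    v - w ∈ box d (m + n) := by
  rw [sub_eq_add_neg]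
  exact add_mem_box hv (neg_mem_box hw)

theorem box_mono {d m n : ℕ} (h : m ≤ n) : box d m ⊆ box d n := by
  intro v hv
  rw [mem_box] at *
  intro i
  have : (m : ℤ) ≤ n := by exact_mod_cast h
  exact (hv i).trans this

theorem exists_mem_box {d : ℕ} (v : Zd d) : ∃ n, v ∈ box d n := by
  refine ⟨Finset.univ.sup fun i => (v i).natAbs, mem_box.2 fun i => ?_⟩
  rw [Int.abs_eq_natAbs]
  exact_mod_cast Finset.le_sup (f := fun i => (v i).natAbs) (Finset.mem_univ i)

theorem exists_box_subset {d : ℕ} (s : Finset (Zd d)) : ∃ n, s ⊆ box d n := by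
  choose f hf using fun v : Zd d => exists_mem_box v
  exact ⟨s.sup f, fun v hv => box_mono (Finset.le_sup hv) (hf v)⟩

/-! ### Expansion and rematching inside one orbit. -/

/-- The points of `b` reachable from `s` by a displacement in the box of size `r`. -/
def neighbors {d : ℕ} (r : ℕ) (b : Set (Zd d)) (s : Finset (Zd d)) : Finset (Zd d) := by
  classical exact (s.biUnion fun v => (box d r).image (· + v)).filter (· ∈ b)

theorem mem_neighbors {d r : ℕ} {b : Set (Zd d)} {s : Finset (Zd d)} {w : Zd d} :
    w ∈ neighbors r b s ↔ w ∈ b ∧ ∃ v ∈ s, w - v ∈ box d r := by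
  classical
  simp only [neighbors, Finset.mem_filter, Finset.mem_biUnion, Finset.mem_image]
  constructor
  · rintro ⟨⟨v, hv, e, he, rfl⟩, hw⟩
    exact ⟨hw, v, hv, by simpa using he⟩
  · rintro ⟨hw, v, hv, h⟩
    exact ⟨⟨v, hv, _, h, by simp⟩, hw⟩

/-- If every translate of `F` contains more points of `b` than of `a`, then finite subsets of `a`
expand by a fixed factor into `b`. -/
theorem card_neighbors_ge {d n : ℕ} {a b : Set (Zd d)} [DecidablePred (· ∈ a)]
    [DecidablePred (· ∈ b)]
    (h : ∀ p : Zd d, ((box d n).filter (· + p ∈ a)).card < ((box d n).filter (· + p ∈ b)).card)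
    (s : Finset (Zd d)) (hs : ∀ v ∈ s, v ∈ a) :
    ((box d n).card + 1) * s.card ≤ (box d n).card * (neighbors (n + n) b s).card := by
  classical
  set F := box d n
  set N := neighbors (n + n) b s
  -- Double counting over the positions p for which p + F meets `s`. Each such window gains at least
  -- one point, and there are at least |s| of them.
  let P : Finset (Zd d) := s.biUnion fun v => F.image fun f => v - f
  have hP : ∀ p, p ∈ P ↔ ∃ v ∈ s, ∃ f ∈ F, v - f = p := by
    simp [P]
  have hsP : s ⊆ P := fun v hv => (hP v).2 ⟨v, hv, 0, zero_mem_box d n, by simp⟩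
  have h1 : ∀ p ∈ P, (F.filter (· + p ∈ s)).card + 1 ≤ (F.filter (· + p ∈ N)).card := by
    intro p hp
    obtain ⟨v, hv, f, hf, rfl⟩ := (hP p).1 hp
    refine le_trans ?_ ((Nat.succ_le_of_lt (h (v - f))).trans ?_)
    · refine Nat.succ_le_succ (Finset.card_le_card fun x hx => ?_)
      rw [Finset.mem_filter] at hx ⊢
      exact ⟨hx.1, hs _ hx.2⟩
    · refine Finset.card_le_card fun x hx => ?_
      simp only [Finset.mem_filter] at hx ⊢
      refine ⟨hx.1, mem_neighbors.2 ⟨hx.2, v, hv, ?_⟩⟩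
      have := sub_mem_box hx.1 hf
      convert this using 1
      abel
  have h2 : ∑ p ∈ P, (F.filter (· + p ∈ N)).card ≤ F.card * N.card := by
    simp only [Finset.card_filter]
    rw [Finset.sum_comm, ← smul_eq_mul]
    refine Finset.sum_le_card_nsmul _ _ _ fun f _ => ?_
    rw [← Finset.card_filter]
    exact Finset.card_le_card_of_injOn (f + ·) (fun p hp => by simpa using (Finset.mem_filter.1 hp).2)
      (fun _ _ _ _ e => add_left_cancel e)
  have h3 : F.card * s.card ≤ ∑ p ∈ P, (F.filter (· + p ∈ s)).card := by
    simp only [Finset.card_filter]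
    rw [Finset.sum_comm, ← smul_eq_mul]
    refine Finset.card_nsmul_le_sum _ _ _ fun f hf => ?_
    rw [← Finset.card_filter]
    refine Finset.card_le_card_of_injOn (· - f) (fun v hv => ?_) (fun _ _ _ _ e => sub_left_injective e)
    simp only [Finset.coe_filter, Set.mem_ofPred_eq]
    exact ⟨(hP _).2 ⟨v, hv, f, hf, rfl⟩, by simpa using hv⟩
  have h4 := Finset.sum_le_sum h1
  rw [Finset.sum_add_distrib, Finset.sum_const, smul_eq_mul, mul_one] at h4
  have := Finset.card_le_card hsP
  nlinarith

/-- Given a partial matching with domain `a'` and target map `t`, the function `ρ` prescribes new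
targets for the points of `insert 0 a'` in the box of size `R` that do not collide with the old
targets of the points of `a'` outside that box. -/
structure IsRematch {d : ℕ} (R r : ℕ) (a' b : Set (Zd d)) (t ρ : Zd d → Zd d) : Prop where
  disp : ∀ v ∈ box d R, v = 0 ∨ v ∈ a' → ρ v - v ∈ box d r
  mem : ∀ v ∈ box d R, v = 0 ∨ v ∈ a' → ρ v ∈ b
  inj : ∀ v ∈ box d R, ∀ w ∈ box d R, v = 0 ∨ v ∈ a' → w = 0 ∨ w ∈ a' → ρ v = ρ w → v = w
  ne : ∀ v ∈ box d R, ∀ w ∈ box d (R + 2 * r), v = 0 ∨ v ∈ a' → w ∈ a' → w ∉ box d R →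
    ρ v ≠ t w

/-- Hall's theorem in the box of size R. The old matching serves every point except possibly 0, so a
violating set must contain 0 and have a deficit of exactly one; expansion then makes it too large
for the box. -/
theorem exists_isRematch {d q r L : ℕ} {a a' b : Set (Zd d)} {t : Zd d → Zd d}
    (ha' : a' ⊆ a) (h0 : 0 ∈ a) (ht : ∀ v ∈ a', t v - v ∈ box d r) (htb : ∀ v ∈ a', t v ∈ b)
    (tinj : Set.InjOn t a')
    (hexp : ∀ s : Finset (Zd d), (∀ v ∈ s, v ∈ a) → (q + 1) * s.card ≤ q * (neighbors r b s).card)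
    (hL : q ^ L * (box d (2 * L * r)).card < (q + 1) ^ L) :
    ∃ ρ, IsRematch (2 * L * r) r a' b t ρ := by
  classical
  set R := 2 * L * r with hR
  let ι := {v : Zd d // v ∈ box d R ∧ (v = 0 ∨ v ∈ a')}
  let T : ι → Finset (Zd d) := fun v =>
    (neighbors r b {v.1}).filter fun w => ∀ u ∈ a', u ∉ box d R → t u ≠ w
  have hT : ∀ (v : ι) w, w ∈ T v ↔ (w ∈ b ∧ w - v.1 ∈ box d r) ∧
      ∀ u ∈ a', u ∉ box d R → t u ≠ w := by
    intro v w
    simp only [T, Finset.mem_filter, mem_neighbors, Finset.mem_singleton, exists_eq_left]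
  have hall : ∀ s : Finset ι, s.card ≤ (s.biUnion T).card := by
    intro s
    by_contra! hlt
    set S : Finset (Zd d) := s.map (Function.Embedding.subtype _) with hS
    have hSc : S.card = s.card := Finset.card_map _
    have memS : ∀ v, v ∈ S ↔ ∃ h, (⟨v, h⟩ : ι) ∈ s := by
      intro v; simp [hS, ι]
    set S' := S.filter (· ∈ a') with hS'
    have hsub : S'.image t ⊆ s.biUnion T := by
      intro w hw
      obtain ⟨v, hv, rfl⟩ := Finset.mem_image.1 hw
      obtain ⟨hv, hva⟩ := Finset.mem_filter.1 hv
      obtain ⟨h, hvs⟩ := (memS v).1 hv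
      refine Finset.mem_biUnion.2 ⟨_, hvs, (hT _ _).2 ⟨⟨htb v hva, ht v hva⟩, ?_⟩⟩
      intro u hu hub e
      exact hub (tinj hu hva e ▸ h.1)
    have hcard : (S'.image t).card = S'.card :=
      Finset.card_image_of_injOn fun x hx y hy e =>
        tinj (Finset.mem_filter.1 hx).2 (Finset.mem_filter.1 hy).2 e
    have hle := Finset.card_le_card hsub
    -- Otherwise `t` itself injects S into its admissible targets, and Hall's condition holds.
    have h0S : 0 ∈ S ∧ (0 : Zd d) ∉ a' := by
      by_contra hcon
      have : S' = S := Finset.filter_true_of_mem fun v hv => by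
        obtain ⟨h, -⟩ := (memS v).1 hv
        rcases h.2 with rfl | h
        · by_contra h'; exact hcon ⟨hv, h'⟩
        · exact h
      rw [this] at hcard hle
      omega
    have hS'e : S' = S.erase 0 := by
      ext v
      rw [hS', Finset.mem_filter, Finset.mem_erase]
      constructor
      · rintro ⟨hv, hva⟩
        exact ⟨fun h => h0S.2 (h ▸ hva), hv⟩
      · rintro ⟨hv, hvS⟩
        obtain ⟨h, -⟩ := (memS v).1 hvS
        exact ⟨hvS, h.2.resolve_left hv⟩
    -- There are fewer than |S| targets, and |S| - 1 of them are old ones: every admissible target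
    -- of S is already held by a point of S.
    have hEq : S'.image t = s.biUnion T := by
      refine Finset.eq_of_subset_of_card_le hsub ?_
      rw [hcard, hS'e, Finset.card_erase_of_mem h0S.1]
      omega
    have hSa : ∀ v ∈ S, v ∈ a := by
      intro v hv
      obtain ⟨h, -⟩ := (memS v).1 hv
      rcases h.2 with rfl | h
      exacts [h0, ha' h]
    let B : ℕ → Finset (Zd d) := fun k => S.filter (· ∈ box d (2 * k * r))
    -- A target is within r of `B k`, and its holder within r of the target, so the radius grows by
    -- 2r. As k < L, a holder in a' stays in the box of size R, so the target is admissible.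
    have step : ∀ k < L, (q + 1) * (B k).card ≤ q * (B (k + 1)).card := by
      intro k hk
      refine (hexp (B k) fun v hv => hSa v (Finset.mem_filter.1 hv).1).trans ?_
      refine Nat.mul_le_mul_left _ ?_
      refine le_trans (Finset.card_le_card (t := (B (k + 1)).image t) ?_) Finset.card_image_le
      intro w hw
      obtain ⟨hwb, v, hv, hwv⟩ := mem_neighbors.1 hw
      obtain ⟨hvS, hvk⟩ := Finset.mem_filter.1 hv
      have near : ∀ u ∈ a', t u = w → u ∈ box d (2 * (k + 1) * r) := by
        rintro u hu rfl
        have := sub_mem_box (add_mem_box hvk hwv) (ht u hu)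
        convert this using 1
        · congr 1; ring
        · abel
      have hw' : w ∈ s.biUnion T := by
        obtain ⟨h, hvs⟩ := (memS v).1 hvS
        refine Finset.mem_biUnion.2 ⟨_, hvs, (hT _ _).2 ⟨⟨hwb, hwv⟩, ?_⟩⟩
        intro u hu hub e
        refine hub (box_mono ?_ (near u hu e))
        rw [hR]
        exact Nat.mul_le_mul_right _ (Nat.mul_le_mul_left _ hk)
      rw [← hEq] at hw'
      obtain ⟨u, hu, rfl⟩ := Finset.mem_image.1 hw'
      obtain ⟨huS, hua⟩ := Finset.mem_filter.1 hu
      exact Finset.mem_image_of_mem _ (Finset.mem_filter.2 ⟨huS, near u hua rfl⟩)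
    have growth : ∀ k ≤ L, (q + 1) ^ k ≤ q ^ k * (B k).card := by
      intro k
      induction k with
      | zero =>
        intro _
        have : 0 < (B 0).card :=
          Finset.card_pos.2 ⟨0, Finset.mem_filter.2 ⟨h0S.1, zero_mem_box _ _⟩⟩
        simpa using this
      | succ k ih =>
        intro hk
        calc (q + 1) ^ (k + 1) = (q + 1) ^ k * (q + 1) := pow_succ _ _
          _ ≤ q ^ k * (B k).card * (q + 1) := Nat.mul_le_mul_right _ (ih (by omega))
          _ = q ^ k * ((q + 1) * (B k).card) := by ring
          _ ≤ q ^ k * (q * (B (k + 1)).card) := Nat.mul_le_mul_left _ (step k (by omega))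
          _ = _ := by ring
    have h1 := growth L le_rfl
    have h2 : (B L).card ≤ (box d R).card :=
      Finset.card_le_card fun v hv => (Finset.mem_filter.1 hv).2
    have := Nat.mul_le_mul_left (q ^ L) h2
    omega
  obtain ⟨f, finj, hf⟩ := (Finset.all_card_le_biUnion_card_iff_exists_injective T).1 hall
  refine ⟨fun v => if h : v ∈ box d R ∧ (v = 0 ∨ v ∈ a') then f ⟨v, h⟩ else 0, ?_, ?_, ?_, ?_⟩
  · intro v hv h
    rw [dif_pos ⟨hv, h⟩]
    exact ((hT _ _).1 (hf ⟨v, hv, h⟩)).1.2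
  · intro v hv h
    rw [dif_pos ⟨hv, h⟩]
    exact ((hT _ _).1 (hf ⟨v, hv, h⟩)).1.1
  · intro v hv w hw h h' e
    rw [dif_pos ⟨hv, h⟩, dif_pos ⟨hw, h'⟩] at e
    exact congrArg Subtype.val (finj e)
  · intro v hv w _ h hw hwR
    rw [dif_pos ⟨hv, h⟩]
    exact (((hT _ _).1 (hf ⟨v, hv, h⟩)).2 w hw hwR).symm

/-- Exponential growth beats the polynomial growth of boxes. -/
theorem exists_growth (d q r : ℕ) :
    ∃ L : ℕ, q ^ L * (box d (2 * L * r)).card < (q + 1) ^ L := by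
  rcases Nat.eq_zero_or_pos q with rfl | hq
  · exact ⟨1, by simp⟩
  have hq' : (0 : ℝ) < q := by exact_mod_cast hq
  have h1 : (1 : ℝ) < (q + 1) / q := by
    rw [lt_div_iff₀ hq']; linarith
  have lim := tendsto_pow_const_div_const_pow_of_one_lt d h1
  -- For L ≥ 1 the side 4Lr + 1 is at most L(4r + 1), so it suffices to beat L^d (4r + 1)^d.
  have hpos : (0 : ℝ) < ((4 * r + 1 : ℝ) ^ d)⁻¹ := by positivity
  obtain ⟨L, hL, hL1⟩ := ((lim.eventually (gt_mem_nhds hpos)).and (eventually_ge_atTop 1)).exists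
  refine ⟨L, ?_⟩
  rw [card_box]
  have hb : (0 : ℝ) < ((q + 1) / q : ℝ) ^ L := by positivity
  rw [div_lt_iff₀ hb, inv_mul_eq_div, lt_div_iff₀ (by positivity), ← mul_pow, div_pow,
    lt_div_iff₀ (by positivity)] at hL
  have h2 : (2 * (2 * L * r) + 1 : ℝ) ≤ L * (4 * r + 1) := by
    have : (1 : ℝ) ≤ L := by exact_mod_cast hL1
    nlinarith
  have h3 : ((2 * (2 * L * r) + 1 : ℝ)) ^ d ≤ (L * (4 * r + 1)) ^ d :=
    pow_le_pow_left₀ (by positivity) h2 d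
  have : (q : ℝ) ^ L * (2 * (2 * L * r) + 1) ^ d < (q + 1) ^ L := by
    refine lt_of_le_of_lt ?_ hL
    rw [mul_comm]
    gcongr
  exact_mod_cast this

/-! ### Continuous matchings in Z. -/

section

theorem eventually_eq_of_continuous {X D : Type*} [TopologicalSpace X] [TopologicalSpace D]
    [DiscreteTopology D] {f : X → D} (hf : Continuous f) (x : X) : ∀ᶠ y in 𝓝 x, f y = f x :=
  ((IsLocallyConstant.iff_continuous f).2 hf).eventually_eq x

theorem continuous_of_eventually_eq {X D : Type*} [TopologicalSpace X] [TopologicalSpace D]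
    {f : X → D} (hf : ∀ x, ∀ᶠ y in 𝓝 x, f y = f x) : Continuous f :=
  continuous_iff_continuousAt.2 fun x => continuousAt_const.congr ((hf x).mono fun _ h => h.symm)

theorem eventually_mem_iff_of_isClopen {X : Type*} [TopologicalSpace X] {V : Set X}
    (hV : IsClopen V) (x : X) : ∀ᶠ y in 𝓝 x, (y ∈ V ↔ x ∈ V) := by
  by_cases hx : x ∈ V
  · filter_upwards [hV.isOpen.mem_nhds hx] with y hy
    exact iff_of_true hy hx
  · filter_upwards [hV.compl.isOpen.mem_nhds hx] with y hy
    exact iff_of_false hy hx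

/-- New targets lie in the box of size R + r, and old targets can collide with them only from within
R + 2r. Being a rematch is thus a finite condition, hence locally constant in the base point. -/
theorem IsRematch.congr {d R r : ℕ} {a a' b b' : Set (Zd d)} {t t' ρ : Zd d → Zd d}
    (h : IsRematch R r a b t ρ)
    (e : ∀ v ∈ box d (R + 2 * r), (v ∈ a ↔ v ∈ a') ∧ (v ∈ b ↔ v ∈ b') ∧ t v = t' v) :
    IsRematch R r a' b' t' ρ := by
  have ea : ∀ v ∈ box d R, v = 0 ∨ v ∈ a' → v = 0 ∨ v ∈ a := fun v hv =>
    Or.imp_right (e v (box_mono (by omega) hv)).1.2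
  refine ⟨fun v hv h' => h.disp v hv (ea v hv h'), fun v hv h' => ?_,
    fun v hv w hw h1 h2 => h.inj v hv w hw (ea v hv h1) (ea w hw h2), fun v hv w hw h1 h2 h3 => ?_⟩
  · refine (e _ ?_).2.1.1 (h.mem v hv (ea v hv h'))
    have := add_mem_box (h.disp v hv (ea v hv h')) hv
    rw [sub_add_cancel] at this
    exact box_mono (by omega) this
  · rw [← (e w hw).2.2]
    exact h.ne v hv w hw (ea v hv h1) ((e w hw).1.2 h2) h3

variable {d : ℕ} {Z : Type*} [TopologicalSpace Z] [AddAction (Zd d) Z]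

/-- The map `z ↦ s(z) + z` embeds `A` into `B`, the displacement `s` is locally constant, and on
`A` it takes values in the box of size `r`. -/
structure IsMatching (r : ℕ) (A B : Set Z) (s : Z → Zd d) : Prop where
  continuous : Continuous s
  disp : ∀ z ∈ A, s z ∈ box d r
  mem : ∀ z ∈ A, s z +ᵥ z ∈ B
  inj : Set.InjOn (fun z => s z +ᵥ z) A

variable [ContinuousConstVAdd (Zd d) Z] [IsCancelVAdd (Zd d) Z]

theorem exists_continuous_rematch {q r L : ℕ} {A B V : Set Z} {s : Z → Zd d}
    (hA : IsClopen A) (hB : IsClopen B) (hV : IsClopen V)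
    (hL : q ^ L * (box d (2 * L * r)).card < (q + 1) ^ L)
    (hexp : ∀ (z : Z) (S : Finset (Zd d)), (∀ v ∈ S, v +ᵥ z ∈ A) →
      (q + 1) * S.card ≤ q * (neighbors r {v | v +ᵥ z ∈ B} S).card)
    (hs : IsMatching r (A ∩ V) B s) :
    ∃ ρ : Z → Zd d → Zd d, (∀ c, ∀ᶠ c' in 𝓝 c, ρ c' = ρ c) ∧
      ∀ c ∈ A, IsRematch (2 * L * r) r {v | v +ᵥ c ∈ A ∩ V} {v | v +ᵥ c ∈ B}
        (fun v => s (v +ᵥ c) + v) (ρ c) := by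
  let P : Z → (Zd d → Zd d) → Prop := fun c =>
    IsRematch (2 * L * r) r {v | v +ᵥ c ∈ A ∩ V} {v | v +ᵥ c ∈ B} (fun v => s (v +ᵥ c) + v)
  refine ⟨fun c => Classical.epsilon (P c), fun c => ?_, fun c hc => ?_⟩
  · have key : ∀ᶠ c' in 𝓝 c, ∀ v ∈ box d (2 * L * r + 2 * r),
        (v +ᵥ c' ∈ A ∩ V ↔ v +ᵥ c ∈ A ∩ V) ∧ (v +ᵥ c' ∈ B ↔ v +ᵥ c ∈ B) ∧
          s (v +ᵥ c') + v = s (v +ᵥ c) + v := by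
      refine (Finset.eventually_all _).2 fun v _ => ?_
      have hv : Tendsto (v +ᵥ · : Z → Z) (𝓝 c) (𝓝 (v +ᵥ c)) :=
        (continuous_const_vadd v).continuousAt
      filter_upwards [hv.eventually (eventually_mem_iff_of_isClopen (hA.inter hV) _),
        hv.eventually (eventually_mem_iff_of_isClopen hB _),
        hv.eventually (eventually_eq_of_continuous hs.continuous _)] with c' h1 h2 h3
      exact ⟨h1, h2, by rw [h3]⟩
    filter_upwards [key] with c' h
    -- Equal predicates have the same `Classical.epsilon`, so the choice is locally constant.
    have : P c' = P c := by
      funext ρ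
      refine propext ⟨fun hρ => hρ.congr h, fun hρ => hρ.congr fun v hv => ?_⟩
      obtain ⟨h1, h2, h3⟩ := h v hv
      exact ⟨h1.symm, h2.symm, h3.symm⟩
    rw [this]
  · refine Classical.epsilon_spec (p := P c) (exists_isRematch (a := {v | v +ᵥ c ∈ A})
      (fun v hv => hv.1) (by simpa using hc) (fun v hv => ?_) (fun v hv => ?_) (fun v hv w hw e => ?_)
      (hexp c) hL)
    · simpa using hs.disp _ hv
    · simpa [add_vadd] using hs.mem _ hv
    · have := congrArg (· +ᵥ c) e
      simp only [add_vadd] at this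
      exact IsCancelVAdd.right_cancel _ _ _ (hs.inj hv hw this)

/-- Rematch around each c in A ∩ U and keep `s` elsewhere. By `hsep` the boxes of size R + r around
different centres in one orbit are disjoint, so the rematchings do not interfere. -/
theorem IsMatching.exists_extend {q r L : ℕ} {A B V U : Set Z} {s : Z → Zd d}
    (hA : IsClopen A) (hB : IsClopen B) (hV : IsClopen V) (hU : IsClopen U)
    (hL : q ^ L * (box d (2 * L * r)).card < (q + 1) ^ L)
    (hexp : ∀ (z : Z) (S : Finset (Zd d)), (∀ v ∈ S, v +ᵥ z ∈ A) →
      (q + 1) * S.card ≤ q * (neighbors r {v | v +ᵥ z ∈ B} S).card)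
    (hsep : ∀ v ∈ box d (2 * (2 * L * r + r)), v ≠ 0 → ∀ z ∈ U, v +ᵥ z ∉ U)
    (hs : IsMatching r (A ∩ V) B s) :
    ∃ s' : Z → Zd d, IsMatching r (A ∩ (V ∪ U)) B s' := by
  classical
  obtain ⟨ρ, hloc, hρ⟩ := exists_continuous_rematch hA hB hV hL hexp hs
  set R := 2 * L * r
  have uniq : ∀ v ∈ box d (2 * (R + r)), ∀ c ∈ U, v +ᵥ c ∈ U → v = 0 := by
    intro v hv c hc h
    by_contra h0
    exact hsep v hv h0 c hc h
  let s' : Z → Zd d := fun z =>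
    if h : ∃ v ∈ box d R, -v +ᵥ z ∈ A ∩ U then ρ (-h.choose +ᵥ z) h.choose - h.choose else s z
  have s'_in : ∀ z, ∀ v ∈ box d R, -v +ᵥ z ∈ A ∩ U → s' z = ρ (-v +ᵥ z) v - v := by
    intro z v hv hz
    have h : ∃ v ∈ box d R, -v +ᵥ z ∈ A ∩ U := ⟨v, hv, hz⟩
    have : h.choose = v := by
      have h1 := h.choose_spec.1
      have h2 := h.choose_spec.2
      generalize h.choose = w at h1 h2
      have := uniq (v - w) (box_mono (by omega) (sub_mem_box hv h1)) _ hz.2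
        (by rw [vadd_vadd, show v - w + -v = -w by abel]; exact h2.2)
      exact (sub_eq_zero.1 this).symm
    simp only [s', dif_pos h, this]
  have s'_out : ∀ z, (∀ v ∈ box d R, -v +ᵥ z ∉ A ∩ U) → s' z = s z := by
    intro z hz
    exact dif_neg fun ⟨v, hv, h⟩ => hz v hv h
  have dichotomy : ∀ z ∈ A ∩ (V ∪ U),
      (∃ c ∈ A ∩ U, ∃ v ∈ box d R, (v = 0 ∨ v +ᵥ c ∈ A ∩ V) ∧ z = v +ᵥ c ∧ s' z = ρ c v - v) ∨
      (z ∈ A ∩ V ∧ (∀ v ∈ box d R, -v +ᵥ z ∉ A ∩ U) ∧ s' z = s z) := by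
    rintro z ⟨hzA, hzV⟩
    by_cases h : ∃ v ∈ box d R, -v +ᵥ z ∈ A ∩ U
    · left
      obtain ⟨v, hv, hz⟩ := h
      refine ⟨_, hz, v, hv, ?_, by simp, s'_in z v hv hz⟩
      rw [vadd_vadd, add_neg_cancel, zero_vadd]
      rcases hzV with hzV | hzU
      · exact Or.inr ⟨hzA, hzV⟩
      · exact Or.inl (uniq v (box_mono (by omega) hv) _ hz.2 (by simpa using hzU))
    · right
      push Not at h
      refine ⟨⟨hzA, hzV.resolve_right fun hzU => h 0 (zero_mem_box _ _) ?_⟩, h, s'_out z h⟩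
      simpa using ⟨hzA, hzU⟩
  have target : ∀ c ∈ A ∩ U, ∀ v ∈ box d R, (v = 0 ∨ v +ᵥ c ∈ A ∩ V) → ρ c v ∈ box d (r + R) := by
    intro c hc v hv h
    have := add_mem_box ((hρ c hc.1).disp v hv h) hv
    rwa [sub_add_cancel] at this
  -- A rematched point and an untouched one cannot collide: this is the clause `ne` of `IsRematch`.
  have mixed : ∀ c ∈ A ∩ U, ∀ v ∈ box d R, (v = 0 ∨ v +ᵥ c ∈ A ∩ V) →
      ∀ z ∈ A ∩ V, (∀ v ∈ box d R, -v +ᵥ z ∉ A ∩ U) → ρ c v +ᵥ c ≠ s z +ᵥ z := by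
    intro c hc v hv h z hz hout e
    obtain ⟨w, rfl⟩ : ∃ w : Zd d, z = w +ᵥ c := by
      refine ⟨-s z + ρ c v, ?_⟩
      rw [add_vadd, e, vadd_vadd, neg_add_cancel, zero_vadd]
    have hw : ρ c v = s (w +ᵥ c) + w := by
      rw [vadd_vadd] at e
      exact IsCancelVAdd.right_cancel _ _ _ e
    refine (hρ c hc.1).ne v hv w ?_ h hz (fun hwR => hout w hwR (by simpa using hc)) hw
    have := sub_mem_box (target c hc v hv h) (hs.disp _ hz)
    rw [hw, add_sub_cancel_left] at this
    exact box_mono (by omega) this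
  refine ⟨s', continuous_of_eventually_eq fun z => ?_, fun z hz => ?_, fun z hz => ?_, ?_⟩
  · by_cases h : ∃ v ∈ box d R, -v +ᵥ z ∈ A ∩ U
    · obtain ⟨v, hv, hz⟩ := h
      have ht : Tendsto (-v +ᵥ · : Z → Z) (𝓝 z) (𝓝 (-v +ᵥ z)) :=
        (continuous_const_vadd (-v)).continuousAt
      filter_upwards [ht.eventually ((hA.inter hU).isOpen.mem_nhds hz),
        ht.eventually (hloc (-v +ᵥ z))] with y hy hy'
      rw [s'_in z v hv hz, s'_in y v hv hy, hy']
    · push Not at h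
      have : ∀ᶠ y in 𝓝 z, ∀ v ∈ box d R, -v +ᵥ y ∉ A ∩ U :=
        (Finset.eventually_all _).2 fun v hv =>
          (continuous_const_vadd (-v)).continuousAt.eventually
            ((hA.inter hU).compl.isOpen.mem_nhds (h v hv))
      filter_upwards [this, eventually_eq_of_continuous hs.continuous z] with y hy hy'
      rw [s'_out z h, s'_out y hy, hy']
  · rcases dichotomy z hz with ⟨c, hc, v, hv, h, rfl, e⟩ | ⟨hz, -, e⟩
    · rw [e]; exact (hρ c hc.1).disp v hv h
    · rw [e]; exact hs.disp z hz
  · rcases dichotomy z hz with ⟨c, hc, v, hv, h, rfl, e⟩ | ⟨hz, -, e⟩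
    · rw [e, vadd_vadd, sub_add_cancel]; exact (hρ c hc.1).mem v hv h
    · rw [e]; exact hs.mem z hz
  · intro z hz z' hz' e
    simp only at e
    rcases dichotomy z hz with ⟨c, hc, v, hv, h, rfl, e1⟩ | ⟨hzV, hout, e1⟩ <;>
    rcases dichotomy z' hz' with ⟨c', hc', v', hv', h', rfl, e2⟩ | ⟨hzV', hout', e2⟩
    · rw [e1, e2, vadd_vadd, vadd_vadd, sub_add_cancel, sub_add_cancel] at e
      have hcc : c' = (-ρ c' v' + ρ c v) +ᵥ c := by
        rw [add_vadd, e, vadd_vadd, neg_add_cancel, zero_vadd]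
      have h0 := uniq _ (box_mono (by omega) (add_mem_box (neg_mem_box (target c' hc' v' hv' h'))
        (target c hc v hv h))) c hc.2 (hcc ▸ hc'.2)
      rw [h0, zero_vadd] at hcc
      subst hcc
      rw [(hρ c' hc.1).inj v hv v' hv' h h' (IsCancelVAdd.right_cancel _ _ _ e)]
    · rw [e1, e2, vadd_vadd, sub_add_cancel] at e
      exact (mixed c hc v hv h z' hzV' hout' e).elim
    · rw [e1, e2, vadd_vadd, sub_add_cancel] at e
      exact (mixed c' hc' v' hv' h' z hzV hout e.symm).elim
    · rw [e1, e2] at e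
      exact hs.inj hzV hzV' e

theorem exists_isOpen_vadd_notMem [T2Space Z] (v : Zd d) (hv : v ≠ 0) (z : Z) :
    ∃ W : Set Z, IsOpen W ∧ z ∈ W ∧ ∀ y ∈ W, v +ᵥ y ∉ W := by
  have hne : v +ᵥ z ≠ z := fun h => hv (IsCancelVAdd.right_cancel v 0 z (by simpa using h))
  obtain ⟨P, Q, hP, hQ, hzP, hzQ, hd⟩ := t2_separation hne
  refine ⟨Q ∩ (v +ᵥ ·) ⁻¹' P, hQ.inter (hP.preimage (continuous_const_vadd v)), ⟨hzQ, hzP⟩, ?_⟩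
  intro y hy hy'
  exact hd.le_bot ⟨hy.2, hy'.1⟩

variable [CompactSpace Z] [T2Space Z] [TotallyDisconnectedSpace Z]

theorem exists_isClopen_separated (M : ℕ) (z : Z) :
    ∃ U : Set Z, IsClopen U ∧ z ∈ U ∧ ∀ v ∈ box d M, v ≠ 0 → ∀ y ∈ U, v +ᵥ y ∉ U := by
  choose W hWo hzW hW using fun v : {v : Zd d // v ≠ 0} => exists_isOpen_vadd_notMem v.1 v.2 z
  have ho : IsOpen (⋂ v ∈ box d M, ⋂ h : v ≠ 0, W ⟨v, h⟩) :=
    isOpen_biInter_finset fun v _ => isOpen_iInter_of_finite fun h => hWo _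
  obtain ⟨U, hU, hzU, hUW⟩ := compact_exists_isClopen_in_isOpen ho
    (Set.mem_iInter₂.2 fun v _ => Set.mem_iInter.2 fun h => hzW ⟨v, h⟩)
  refine ⟨U, hU, hzU, fun v hv h y hy hy' => hW ⟨v, h⟩ y ?_ ?_⟩
  · exact Set.mem_iInter.1 (Set.mem_iInter₂.1 (hUW hy) v hv) h
  · exact Set.mem_iInter.1 (Set.mem_iInter₂.1 (hUW hy') v hv) h

/-- Comparison: if in every translate of some box there are more points of `B` than of `A`, then
`A` embeds into `B` by a map that moves points within their orbits by a locally constant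
displacement. -/
theorem exists_isMatching {n : ℕ} {A B : Set Z} [DecidablePred (· ∈ A)] [DecidablePred (· ∈ B)]
    (hA : IsClopen A) (hB : IsClopen B)
    (h : ∀ z : Z, ((box d n).filter (· +ᵥ z ∈ A)).card < ((box d n).filter (· +ᵥ z ∈ B)).card) :
    ∃ s : Z → Zd d, IsMatching (n + n) A B s := by
  classical
  have hexp : ∀ (z : Z) (S : Finset (Zd d)), (∀ v ∈ S, v +ᵥ z ∈ A) →
      ((box d n).card + 1) * S.card ≤
        (box d n).card * (neighbors (n + n) {v | v +ᵥ z ∈ B} S).card := by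
    intro z S hS
    refine card_neighbors_ge (a := {v | v +ᵥ z ∈ A}) (fun p => ?_) S hS
    simpa [add_vadd] using h (p +ᵥ z)
  -- One L serves all extension steps, since q and r stay fixed.
  obtain ⟨L, hL⟩ := exists_growth d (box d n).card (n + n)
  choose U hU hzU hsep using
    fun z : Z => exists_isClopen_separated (d := d) (2 * (2 * L * (n + n) + (n + n))) z
  obtain ⟨t, ht⟩ := isCompact_univ.elim_finite_subcover U (fun z => (hU z).isOpen)
    fun z _ => Set.mem_iUnion.2 ⟨z, hzU z⟩
  have key : ∀ t : Finset Z, ∃ s : Z → Zd d, IsMatching (n + n) (A ∩ ⋃ z ∈ t, U z) B s := by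
    intro t
    induction t using Finset.induction_on with
    | empty => exact ⟨fun _ => 0, continuous_const, by simp, by simp, by simp⟩
    | insert z t _ ih =>
      obtain ⟨s, hs⟩ := ih
      rw [Finset.set_biUnion_insert, Set.union_comm]
      exact hs.exists_extend hA hB (isClopen_biUnion_finset fun z _ => hU z) (hU z) hL hexp (hsep z)
  obtain ⟨s, hs⟩ := key t
  rw [Set.univ_subset_iff.1 ht, Set.inter_univ] at hs
  exact ⟨s, hs⟩

end

/-! ### Box sums of coboundaries and of positive functions. -/

section

theorem eventually_card_box_add_le (d k m : ℕ) :
    ∀ᶠ n in atTop, m * (box d (n + k)).card ≤ (m + 1) * (box d n).card := by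
  have h1 : Tendsto (fun n : ℕ => (1 + (2 * k : ℝ) / (2 * n + 1)) ^ d) atTop (𝓝 1) := by
    have h0 : Tendsto (fun n : ℕ => (2 * n + 1 : ℝ)) atTop atTop :=
      tendsto_atTop_add_const_right _ _
        (tendsto_natCast_atTop_atTop.const_mul_atTop (by norm_num))
    simpa using ((h0.const_div_atTop (2 * k : ℝ)).const_add 1).pow d
  have h2 := (h1.const_mul (m : ℝ)).eventually
    (gt_mem_nhds (show (m : ℝ) * 1 < m + 1 by linarith))
  filter_upwards [h2] with n hn
  have hpos : (0 : ℝ) < 2 * n + 1 := by positivity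
  rw [card_box, card_box]
  have e : (1 + (2 * k : ℝ) / (2 * n + 1)) ^ d = (2 * (n + k) + 1) ^ d / (2 * n + 1) ^ d := by
    rw [← div_pow]; congr 1; field_simp; ring
  rw [e, ← mul_div_assoc, div_lt_iff₀ (by positivity)] at hn
  exact_mod_cast hn.le

variable {d : ℕ} {Z : Type*} [TopologicalSpace Z] [AddAction (Zd d) Z]
  [ContinuousConstVAdd (Zd d) Z] [CompactSpace Z]

/-- Sums of a coboundary over large boxes are small relative to the size of the box. -/
theorem eventually_abs_sum_coboundary_le {h : C(Z, ℤ)} (hh : h ∈ coboundaries d Z) :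
    ∀ m : ℕ, ∀ᶠ n in atTop, ∀ z : Z, (m : ℤ) * |∑ v ∈ box d n, h (v +ᵥ z)| ≤ (box d n).card := by
  classical
  rw [coboundaries] at hh
  induction hh using AddSubgroup.closure_induction with
  | mem h hh =>
    obtain ⟨f, u, rfl⟩ := hh
    intro m
    obtain ⟨k, hk⟩ := exists_mem_box u
    obtain ⟨K, hK⟩ : ∃ K : ℕ, ∀ z, |f z| ≤ K := by
      obtain ⟨C, hC⟩ := (isCompact_range f.continuous.abs).bddAbove
      exact ⟨C.toNat, fun z => (hC ⟨z, rfl⟩).trans (Int.self_le_toNat C)⟩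
    filter_upwards [eventually_card_box_add_le d k (2 * m * K)] with n hn z
    have hsub : box d n ⊆ box d (n + k) := box_mono (by omega)
    have hsub' : (box d n).image (· + u) ⊆ box d (n + k) := by
      intro w hw
      obtain ⟨v, hv, rfl⟩ := Finset.mem_image.1 hw
      exact add_mem_box hv hk
    -- The box and its translate by u both lie in the box of size n + k; each sum is compared with
    -- the sum there.
    have bound : ∀ s ⊆ box d (n + k), s.card = (box d n).card →
        |∑ v ∈ box d (n + k), f (v +ᵥ z) - ∑ v ∈ s, f (v +ᵥ z)| ≤
          K * ((box d (n + k)).card - (box d n).card) := by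
      intro s hs hc
      rw [← Finset.sum_sdiff hs, add_sub_cancel_right]
      refine (Finset.abs_sum_le_sum_abs _ _).trans ((Finset.sum_le_card_nsmul _ _ (K : ℤ)
        fun v _ => hK _).trans_eq ?_)
      rw [Finset.card_sdiff_of_subset hs, hc, nsmul_eq_mul,
        Nat.cast_sub (Finset.card_le_card hsub), mul_comm]
    have b1 := bound _ hsub rfl
    have b2 := bound _ hsub' (Finset.card_image_of_injective _ (add_left_injective u))
    rw [Finset.sum_image fun _ _ _ _ e => add_left_injective u e] at b2
    have e : ∑ v ∈ box d n, (f - translate d u f) (v +ᵥ z) =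
        ∑ v ∈ box d n, f (v +ᵥ z) - ∑ v ∈ box d n, f ((v + u) +ᵥ z) := by
      rw [← Finset.sum_sub_distrib]
      refine Finset.sum_congr rfl fun v _ => ?_
      simp [translate, vadd_vadd, add_comm]
    rw [e]
    generalize ∑ v ∈ box d (n + k), f (v +ᵥ z) = S at *
    generalize ∑ v ∈ box d n, f (v +ᵥ z) = S₁ at *
    generalize ∑ v ∈ box d n, f ((v + u) +ᵥ z) = S₂ at *
    have b3 : |S₁ - S₂| ≤ 2 * (K * (((box d (n + k)).card : ℤ) - (box d n).card)) := by
      rw [abs_le] at *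
      constructor <;> linarith [b1.1, b1.2, b2.1, b2.2]
    have hn' : (2 * m * K : ℤ) * (box d (n + k)).card ≤ (2 * m * K + 1) * (box d n).card := by
      exact_mod_cast hn
    have := mul_le_mul_of_nonneg_left b3 (Int.natCast_nonneg m)
    linarith
  | zero =>
    intro m
    filter_upwards with n z
    simp
  | add f g _ _ hf hg =>
    intro m
    -- Each summand takes half of the allowed error.
    filter_upwards [hf (2 * m), hg (2 * m)] with n h1 h2 z
    have h1 := h1 z
    have h2 := h2 z
    simp only [ContinuousMap.add_apply, Finset.sum_add_distrib]
    have := mul_le_mul_of_nonneg_left (abs_add_le (∑ v ∈ box d n, f (v +ᵥ z))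
      (∑ v ∈ box d n, g (v +ᵥ z))) (Int.natCast_nonneg m)
    push_cast at h1 h2
    linarith
  | neg f _ hf =>
    intro m
    filter_upwards [hf m] with n h1 z
    simpa using h1 z

variable [AddAction.IsMinimal (Zd d) Z]

theorem exists_box_hits {V : Set Z} (hV : IsOpen V) (hne : V.Nonempty) :
    ∃ m, ∀ z : Z, ∃ v ∈ box d m, v +ᵥ z ∈ V := by
  obtain ⟨t, ht⟩ := isCompact_univ.elim_finite_subcover (fun v : Zd d => (v +ᵥ · : Z → Z) ⁻¹' V)
    (fun v => hV.preimage (continuous_const_vadd v))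
    (fun z _ => by
      obtain ⟨v, hv⟩ := hV.exists_vadd_mem (Zd d) z hne
      exact Set.mem_iUnion.2 ⟨v, hv⟩)
  obtain ⟨m, hm⟩ := exists_box_subset t
  refine ⟨m, fun z => ?_⟩
  obtain ⟨v, hv, hz⟩ := Set.mem_iUnion₂.1 (ht (Set.mem_univ z))
  exact ⟨v, hm hv, hz⟩

/-- By minimality and compactness g ≥ 1 somewhere in every box of some fixed size m. Summing over
the centres w in the box of size n counts each value of g at most |box m| times. -/
theorem exists_card_box_le_mul_sum {g : C(Z, ℤ)} (hg : ∀ z, 0 ≤ g z) (hg0 : g ≠ 0) :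
    ∃ m, ∀ n, ∀ z : Z,
      ((box d n).card : ℤ) ≤ (box d m).card * ∑ v ∈ box d (n + m), g (v +ᵥ z) := by
  obtain ⟨z₀, hz₀⟩ : ∃ z, g z ≠ 0 := by
    by_contra! hcon
    exact hg0 (ContinuousMap.ext hcon)
  obtain ⟨m, hm⟩ := exists_box_hits (d := d) (V := g ⁻¹' {0}ᶜ)
    ((isOpen_discrete _).preimage g.continuous) ⟨z₀, hz₀⟩
  refine ⟨m, fun n z => ?_⟩
  have h1 : ∀ w ∈ box d n, 1 ≤ ∑ u ∈ box d m, g (u +ᵥ w +ᵥ z) := by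
    intro w _
    obtain ⟨u, hu, hgu⟩ := hm (w +ᵥ z)
    refine le_trans ?_ (Finset.single_le_sum (fun u _ => hg (u +ᵥ w +ᵥ z)) hu)
    have : g (u +ᵥ w +ᵥ z) ≠ 0 := hgu
    have := hg (u +ᵥ w +ᵥ z)
    omega
  have h2 : ∀ u ∈ box d m, ∑ w ∈ box d n, g (u +ᵥ w +ᵥ z) ≤ ∑ v ∈ box d (n + m), g (v +ᵥ z) := by
    classical
    intro u hu
    simp only [vadd_vadd]
    rw [← Finset.sum_image (f := fun v => g (v +ᵥ z)) (g := fun w => u + w)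
      fun _ _ _ _ e => add_left_cancel e]
    refine Finset.sum_le_sum_of_subset_of_nonneg (fun v hv => ?_) fun _ _ _ => hg _
    obtain ⟨w, hw, rfl⟩ := Finset.mem_image.1 hv
    rw [add_comm u]
    exact add_mem_box hw hu
  calc ((box d n).card : ℤ) = ∑ w ∈ box d n, 1 := by simp
    _ ≤ ∑ w ∈ box d n, ∑ u ∈ box d m, g (u +ᵥ w +ᵥ z) := Finset.sum_le_sum h1
    _ = ∑ u ∈ box d m, ∑ w ∈ box d n, g (u +ᵥ w +ᵥ z) := Finset.sum_comm
    _ ≤ ∑ u ∈ box d m, ∑ v ∈ box d (n + m), g (v +ᵥ z) := Finset.sum_le_sum h2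
    _ = _ := by simp

theorem exists_box_sum_pos {g h : C(Z, ℤ)} (hg : ∀ z, 0 ≤ g z) (hg0 : g ≠ 0)
    (hh : h ∈ coboundaries d Z) :
    ∃ n, ∀ z : Z, 0 < ∑ v ∈ box d n, (g (v +ᵥ z) + h (v +ᵥ z)) := by
  obtain ⟨m, hm⟩ := exists_card_box_le_mul_sum (d := d) hg hg0
  -- With M = |box m|, the sum of g is at least |box n| / M. As |box (n + m)| ≤ 2 |box n|, the
  -- factor 3M bounds the coboundary by 2/3 of that.
  obtain ⟨n, h1, h2⟩ := (((tendsto_add_atTop_nat m).eventually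
    (eventually_abs_sum_coboundary_le hh (3 * (box d m).card))).and
    (eventually_card_box_add_le d m 1)).exists
  refine ⟨n + m, fun z => ?_⟩
  rw [Finset.sum_add_distrib]
  have h1 := h1 z
  have h3 := hm n z
  generalize ∑ v ∈ box d (n + m), g (v +ᵥ z) = S at *
  generalize ∑ v ∈ box d (n + m), h (v +ᵥ z) = T at *
  have hpos : (0 : ℤ) < (box d n).card := by
    exact_mod_cast Finset.card_pos.2 ⟨0, zero_mem_box d n⟩
  have h2' : ((box d (n + m)).card : ℤ) ≤ 2 * (box d n).card := by
    have : (box d (n + m)).card ≤ 2 * (box d n).card := by omega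
    exact_mod_cast this
  have hM : (0 : ℤ) ≤ (box d m).card := Int.natCast_nonneg _
  push_cast at h1
  have h4 := mul_le_mul_of_nonneg_left (neg_abs_le T) hM
  by_contra! hcon
  have := mul_nonneg hM (sub_nonneg.2 hcon)
  nlinarith

/-! ### From a matching to an orbit injection. -/

section Transfer

variable {X Y W : Type*} [TopologicalSpace X] [TopologicalSpace Y] [TopologicalSpace W]
  [AddAction (Zd d) X] [AddAction (Zd d) Y] [AddAction (Zd d) W]
  [ContinuousConstVAdd (Zd d) X] [ContinuousConstVAdd (Zd d) W]

theorem isOpenMap_vadd_of_continuous {s : W → Zd d} (hs : Continuous s) :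
    IsOpenMap fun z => s z +ᵥ z := by
  rw [isOpenMap_iff_nhds_le]
  intro z
  have h : (fun y => s y +ᵥ y) =ᶠ[𝓝 z] (s z +ᵥ ·) := by
    filter_upwards [eventually_eq_of_continuous hs z] with y hy
    rw [hy]
  rw [map_congr h]
  exact ((Homeomorph.vadd (s z)).map_nhds_eq z).ge

theorem continuous_vadd_of_continuous {s : W → Zd d} (hs : Continuous s) :
    Continuous fun z => s z +ᵥ z := by
  rw [continuous_iff_continuousAt]
  intro z
  refine (continuous_const_vadd (s z)).continuousAt.congr ?_
  filter_upwards [eventually_eq_of_continuous hs z] with y hy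
  rw [hy]

/-- A matching of the images of two bounded orbit injections yields a bounded orbit injection
between their domains. -/
theorem IsMatching.exists_isBoundedOrbitInjection
    [IsCancelVAdd (Zd d) Y] [IsCancelVAdd (Zd d) W]
    {θ₁ : X → W} {θ₂ : Y → W} {r : ℕ} {s : W → Zd d}
    (h₁ : IsBoundedOrbitInjection d θ₁) (h₂ : IsBoundedOrbitInjection d θ₂)
    (hs : IsMatching r (Set.range θ₁) (Set.range θ₂) s) :
    ∃ θ : X → Y, IsBoundedOrbitInjection d θ := by
  choose θ hθ using fun x => hs.mem (θ₁ x) ⟨x, rfl⟩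
  have comp : θ₂ ∘ θ = (fun z => s z +ᵥ z) ∘ θ₁ := funext hθ
  have hemb : IsOpenEmbedding θ := by
    refine IsOpenEmbedding.of_comp _ h₂.isOpenEmbedding ?_
    rw [comp]
    exact .of_continuous_injective_isOpenMap
      ((continuous_vadd_of_continuous hs.continuous).comp h₁.continuous)
      (fun x y e => h₁.injective (hs.inj ⟨x, rfl⟩ ⟨y, rfl⟩ e))
      ((isOpenMap_vadd_of_continuous hs.continuous).comp h₁.isOpenMap)
  have orbit : ∀ x y : X, (∃ w : Zd d, w +ᵥ x = y) ↔ ∃ v : Zd d, v +ᵥ θ x = θ y := by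
    intro x y
    rw [h₁.orbit_iff, h₂.orbit_iff, hθ, hθ]
    constructor
    · rintro ⟨v, hv⟩
      refine ⟨s (θ₁ y) + v - s (θ₁ x), ?_⟩
      rw [vadd_vadd, sub_add_cancel, add_vadd, hv]
    · rintro ⟨v, hv⟩
      refine ⟨-s (θ₁ y) + v + s (θ₁ x), ?_⟩
      rw [add_vadd, add_vadd, hv, vadd_vadd, neg_add_cancel, zero_vadd]
  refine ⟨θ, ⟨⟨hemb.continuous, hemb.isOpenMap, hemb.injective, orbit⟩, ?_⟩⟩
  choose η hη using fun p : X × Zd d => (orbit p.1 (p.2 +ᵥ p.1)).1 ⟨p.2, rfl⟩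
  refine ⟨η, ?_, fun x w => hη (x, w)⟩
  obtain ⟨η₁, hη₁, e₁⟩ := h₁.bounded
  obtain ⟨η₂, hη₂, e₂⟩ := h₂.bounded
  rw [continuous_prod_of_discrete_right]
  refine fun w => continuous_of_eventually_eq fun x => ?_
  set u := η (x, w)
  have c₁ : Continuous fun y => s (θ₁ (w +ᵥ y)) + η₁ (y, w) :=
    (hs.continuous.comp (h₁.continuous.comp (continuous_const_vadd w))).add
      (hη₁.comp (by fun_prop))
  have c₂ : Continuous fun y => η₂ (θ y, u) + s (θ₁ y) :=
    (hη₂.comp (hemb.continuous.prodMk continuous_const)).add (hs.continuous.comp h₁.continuous)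
  have f₁ : ∀ y, θ₂ (θ (w +ᵥ y)) = (s (θ₁ (w +ᵥ y)) + η₁ (y, w)) +ᵥ θ₁ y := by
    intro y
    rw [hθ, add_vadd, e₁]
  have f₂ : ∀ y, θ₂ (u +ᵥ θ y) = (η₂ (θ y, u) + s (θ₁ y)) +ᵥ θ₁ y := by
    intro y
    rw [← e₂, hθ, add_vadd]
  have hx : η₂ (θ x, u) + s (θ₁ x) = s (θ₁ (w +ᵥ x)) + η₁ (x, w) := by
    refine IsCancelVAdd.right_cancel _ _ (θ₁ x) ?_
    rw [← f₁, ← f₂]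
    exact congrArg θ₂ (hη (x, w))
  -- Near x both displacements keep their values, so u still carries θ y to θ (w + y); freeness then
  -- forces η (y, w) = u.
  filter_upwards [eventually_eq_of_continuous c₁ x, eventually_eq_of_continuous c₂ x] with y h1 h2
  refine IsCancelVAdd.right_cancel _ _ (θ y) ((hη (y, w)).trans (h₂.injective ?_))
  rw [f₁, f₂, h1, h2, hx]

end Transfer

theorem extendByZero_one_apply {V W : Type*} [TopologicalSpace V] [TopologicalSpace W]
    [AddAction (Zd d) V] [AddAction (Zd d) W] [CompactSpace V] [T2Space W] {θ : V → W}
    [DecidablePred (· ∈ Set.range θ)] (h : IsBoundedOrbitInjection d θ) (z : W) :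
    extendByZero h 1 z = if z ∈ Set.range θ then 1 else 0 := by
  split_ifs with hz
  · obtain ⟨x, rfl⟩ := hz
    exact extendByZero_apply h 1 x
  · exact extendByZero_apply' h 1 z hz

end

end OrbitInj

end

theorem mainTheorem3 {d : ℕ} (hd : 0 < d) {X Y Z : Type*}
    [TopologicalSpace X] [TopologicalSpace Y] [TopologicalSpace Z]
    [OrbitInj.IsCantorSpace X] [OrbitInj.IsCantorSpace Y] [OrbitInj.IsCantorSpace Z]
    [AddAction (OrbitInj.Zd d) X] [AddAction (OrbitInj.Zd d) Y] [AddAction (OrbitInj.Zd d) Z]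
    [ContinuousConstVAdd (OrbitInj.Zd d) X] [ContinuousConstVAdd (OrbitInj.Zd d) Y]
    [ContinuousConstVAdd (OrbitInj.Zd d) Z]
    [IsCancelVAdd (OrbitInj.Zd d) X] [IsCancelVAdd (OrbitInj.Zd d) Y]
    [IsCancelVAdd (OrbitInj.Zd d) Z]
    [AddAction.IsMinimal (OrbitInj.Zd d) X] [AddAction.IsMinimal (OrbitInj.Zd d) Y]
    [AddAction.IsMinimal (OrbitInj.Zd d) Z]
    (θ₁ : X → Z) (θ₂ : Y → Z)
    (h₁ : OrbitInj.IsBoundedOrbitInjection d θ₁) (h₂ : OrbitInj.IsBoundedOrbitInjection d θ₂)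
    (hlt : OrbitInj.inducedHom h₁ (OrbitInj.cls d (1 : C(X, ℤ))) <
      OrbitInj.inducedHom h₂ (OrbitInj.cls d (1 : C(Y, ℤ)))) :
    ∃ θ : X → Y, OrbitInj.IsBoundedOrbitInjection d θ := by
  classical
  obtain ⟨⟨g, hg, e⟩, hne⟩ := hlt
  change OrbitInj.cls d (OrbitInj.extendByZero h₂ 1) - OrbitInj.cls d (OrbitInj.extendByZero h₁ 1) =
    OrbitInj.cls d g at e
  -- Strictness of the inequality enters here.
  have hg0 : g ≠ 0 := by
    rintro rfl
    rw [map_zero, sub_eq_zero] at e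
    exact hne e
  have hmem : OrbitInj.extendByZero h₂ 1 - OrbitInj.extendByZero h₁ 1 - g ∈
      OrbitInj.coboundaries d Z := by
    rw [← map_sub] at e
    exact (QuotientAddGroup.eq_iff_sub_mem).1 e
  -- The g terms cancel: the positive box sums are those of 1_B - 1_A, i.e. differences of point
  -- counts.
  obtain ⟨n, hn⟩ := OrbitInj.exists_box_sum_pos hg hg0 hmem
  obtain ⟨s, hs⟩ := OrbitInj.exists_isMatching (d := d) (n := n)
    (A := Set.range θ₁) (B := Set.range θ₂)
    ⟨(isCompact_range h₁.continuous).isClosed, h₁.isOpenMap.isOpen_range⟩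
    ⟨(isCompact_range h₂.continuous).isClosed, h₂.isOpenMap.isOpen_range⟩ (fun z => by
      have := hn z
      simp only [ContinuousMap.sub_apply, add_sub_cancel, Finset.sum_sub_distrib, sub_pos] at this
      simp only [OrbitInj.extendByZero_one_apply] at this
      rw [Finset.sum_boole, Finset.sum_boole] at this
      exact_mod_cast this)
  exact hs.exists_isBoundedOrbitInjection h₁ h₂
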